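/- Let $d\ge 1$ and let $\Omega\subset\mathbb R^d$ be a bounded open set. Let $H_0^1(\Omega)$ be the closure of $C_c^\infty(\Omega)$ in the $H^1(\Omega)$-norm, $H^{-1}(\Omega)$ its dual with dual pairing $\langle\cdot,\cdot\rangle$, and $a(y,v)=\int_\Omega \nabla y\cdot\nabla v\,dx$. Let $(u_\gamma)\subset H^{-1}(\Omega)$ be a family (or a sequence $u_{\gamma_n}$ with $\gamma_n\to\infty$) such that $u_\gamma\to u$ in $H^{-1}(\Omega)$ as $\gamma\to\infty$. For these $\gamma$ let $y_\gamma\in H_0^1(\Omega)$ be the solution of $$a(y_\gamma,v)+\frac2\pi\int_\Omega\arctan(\gamma y_\gamma)\,v\,dx=\langle u_\gamma,v\rangle\qquad\forall v\in H_0^1(\Omega),$$ and let $y\in H_0^1(\Omega)$ be the solution of the variational inequality $$a(y,v-y)+\|v\|_{L^1(\Omega)}-\|y\|_{L^1(\Omega)}\ge\langle u,v-y\rangle\qquad\forall v\in H_0^1(\Omega).$$ Then $y_\gamma\to y$ strongly in $H_0^1(\Omega)$ as $\gamma\to\infty$. -/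

import Mathlib

open MeasureTheory Filter Topology
open scoped ContDiff Gradient

noncomputable section

namespace SemilinearVI

/-- The Hilbert space `L²(Ω) × L²(Ω)ᵈ` with the norm `(‖f‖² + ‖g‖²)^(1/2)`.  A function `y` of
`H¹(Ω)` is represented in it by the pair `(y, ∇y)`, whose norm is the usual `H¹(Ω)`-norm of `y`. -/
abbrev L2Pair {d : ℕ} (Ω : Set (EuclideanSpace ℝ (Fin d))) : Type :=
  WithLp 2 (Lp ℝ 2 (volume.restrict Ω) × Lp (EuclideanSpace ℝ (Fin d)) 2 (volume.restrict Ω))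

/-- The pairs `(φ, ∇φ)` with a test function `φ ∈ C_c^∞(Ω)`. -/
def testPairs {d : ℕ} (Ω : Set (EuclideanSpace ℝ (Fin d))) : Submodule ℝ (L2Pair Ω) where
  carrier := {w | ∃ φ : EuclideanSpace ℝ (Fin d) → ℝ,
    ContDiff ℝ ∞ φ ∧ HasCompactSupport φ ∧ tsupport φ ⊆ Ω ∧
      w.fst =ᵐ[volume.restrict Ω] φ ∧ w.snd =ᵐ[volume.restrict Ω] ∇ φ}
  add_mem' := by
    rintro w z ⟨φ, hφ, hφc, hφs, hw1, hw2⟩ ⟨ψ, hψ, hψc, hψs, hz1, hz2⟩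
    refine ⟨φ + ψ, hφ.add hψ, hφc.add hψc,
      (tsupport_add φ ψ).trans (Set.union_subset hφs hψs), ?_, ?_⟩
    · filter_upwards [Lp.coeFn_add w.fst z.fst, hw1, hz1] with x hx h1 h2
      simpa [h1, h2] using hx
    · filter_upwards [Lp.coeFn_add w.snd z.snd, hw2, hz2] with x hx h1 h2
      have e : ∇ (φ + ψ) x = ∇ φ x + ∇ ψ x := by
        simp [gradient, fderiv_add (hφ.differentiable (by simp) x)
          (hψ.differentiable (by simp) x)]
      rw [e, ← h1, ← h2]
      simpa using hx
  zero_mem' := by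
    refine ⟨0, contDiff_const, HasCompactSupport.zero, by simp [tsupport], ?_, ?_⟩
    · exact Lp.coeFn_zero _ _ _
    · filter_upwards [Lp.coeFn_zero (EuclideanSpace ℝ (Fin d)) 2 (volume.restrict Ω)] with x hx
      have e : ∇ (0 : EuclideanSpace ℝ (Fin d) → ℝ) x = 0 := by simp [gradient]
      rw [e]
      simpa using hx
  smul_mem' := by
    rintro c w ⟨φ, hφ, hφc, hφs, hw1, hw2⟩
    refine ⟨c • φ, contDiff_const.smul hφ, hφc.smul_left,
      (closure_mono (Function.support_const_smul_subset c φ)).trans hφs, ?_, ?_⟩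
    · filter_upwards [Lp.coeFn_smul c w.fst, hw1] with x hx h1
      simpa [h1] using hx
    · filter_upwards [Lp.coeFn_smul c w.snd, hw2] with x hx h1
      have e : ∇ (c • φ) x = c • ∇ φ x := by
        simp [gradient, fderiv_const_smul (hφ.differentiable (by simp) x)]
      rw [e, ← h1]
      simpa using hx

/-- The Sobolev space `H₀¹(Ω)`: the closure of `C_c^∞(Ω)` with respect to the `H¹(Ω)`-norm. -/
def H10 {d : ℕ} (Ω : Set (EuclideanSpace ℝ (Fin d))) : Submodule ℝ (L2Pair Ω) :=
  (testPairs Ω).topologicalClosure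

/-- The function in `L²(Ω)` underlying an element of `H₀¹(Ω)`. -/
def fn {d : ℕ} {Ω : Set (EuclideanSpace ℝ (Fin d))} (y : H10 Ω) :
    Lp ℝ 2 (volume.restrict Ω) :=
  (y : L2Pair Ω).fst

/-- The weak gradient in `L²(Ω)ᵈ` of an element of `H₀¹(Ω)`. -/
def weakGrad {d : ℕ} {Ω : Set (EuclideanSpace ℝ (Fin d))} (y : H10 Ω) :
    Lp (EuclideanSpace ℝ (Fin d)) 2 (volume.restrict Ω) :=
  (y : L2Pair Ω).snd

/-- The dual space `H⁻¹(Ω)` of `H₀¹(Ω)`, with the dual norm. -/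
abbrev Hm1 {d : ℕ} (Ω : Set (EuclideanSpace ℝ (Fin d))) : Type :=
  H10 Ω →L[ℝ] ℝ

/-- The bilinear form `a(y, v) = (∇y, ∇v)`. -/
def dirichletForm {d : ℕ} {Ω : Set (EuclideanSpace ℝ (Fin d))} (y v : H10 Ω) : ℝ :=
  ∫ x in Ω, inner ℝ (weakGrad y x) (weakGrad v x)

/-- The norm of `L¹(Ω)`. -/
def l1Norm {d : ℕ} {Ω : Set (EuclideanSpace ℝ (Fin d))} (y : H10 Ω) : ℝ :=
  ∫ x in Ω, |fn y x|

/-- `y` solves the variational inequality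
`a(y, v - y) + ‖v‖_{L¹(Ω)} - ‖y‖_{L¹(Ω)} ≥ ⟨u, v - y⟩` for all `v ∈ H₀¹(Ω)`. -/
def IsVISolution {d : ℕ} {Ω : Set (EuclideanSpace ℝ (Fin d))} (u : Hm1 Ω) (y : H10 Ω) : Prop :=
  ∀ v : H10 Ω, u (v - y) ≤ dirichletForm y (v - y) + l1Norm v - l1Norm y

/-- The smoothed sign `β_γ(s) = (2/π) arctan(γ s)`. -/
def beta (γ s : ℝ) : ℝ := 2 / Real.pi * Real.arctan (γ * s)

/-- `y` solves the regularized equation `a(y, v) + (β_γ(y), v) = ⟨u, v⟩` for all `v ∈ H₀¹(Ω)`. -/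
def IsRegularizedSolution {d : ℕ} {Ω : Set (EuclideanSpace ℝ (Fin d))} (γ : ℝ) (u : Hm1 Ω)
    (y : H10 Ω) : Prop :=
  ∀ v : H10 Ω, dirichletForm y v + (∫ x in Ω, beta γ (fn y x) * fn v x) = u v

end SemilinearVI

end

/-! The function `beta γ` is an approximate subgradient of the absolute value, with an error `2 / (π
γ)` uniform in its argument. Hence the regularized solution almost satisfies the variational
inequality. Testing the equation with `y - y₀` and the inequality with `v = y`, then adding, bounds
the Dirichlet energy of `y - y₀` by `‖u - u₀‖ ‖y - y₀‖` plus `O(1/γ)` (`dirichletForm_sub_sub_le`).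
Poincaré's inequality makes the energy coercive on `H10 Ω`, and Young's inequality absorbs `‖y -
y₀‖`, leaving the explicit rate `norm_sub_sq_le`. No compactness is needed. -/

namespace SemilinearVI

/-! ### Poincaré inequality and coercivity -/

section Poincare

/-- The Poincaré inequality for compactly supported functions. -/
theorem integral_sq_le_integral_norm_gradient_sq {E : Type*} [NormedAddCommGroup E]
    [InnerProductSpace ℝ E] [FiniteDimensional ℝ E] [MeasurableSpace E] [BorelSpace E]
    {μ : Measure E} [μ.IsAddHaarMeasure] {φ : E → ℝ} (hφ : ContDiff ℝ 1 φ)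
    (hφc : HasCompactSupport φ) {e : E} (he : ‖e‖ = 1) {R : ℝ}
    (hR : ∀ x ∈ tsupport φ, ‖x‖ ≤ R) :
    ∫ x, φ x ^ 2 ∂μ ≤ 4 * R ^ 2 * ∫ x, ‖∇ φ x‖ ^ 2 ∂μ := by
  have hd : Differentiable ℝ φ := hφ.differentiable one_ne_zero
  have hcφ : Continuous φ := hφ.continuous
  have hcf : Continuous (fderiv ℝ φ) := hφ.continuous_fderiv one_ne_zero
  have hcg : Continuous (∇ φ) :=
    (InnerProductSpace.toDual ℝ E).symm.continuous.comp hcf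
  have hgs : HasCompactSupport (∇ φ) := by
    refine (hφc.fderiv ℝ).comp_left (g := (InnerProductSpace.toDual ℝ E).symm) (map_zero _)
  have hf2 (x : E) : fderiv ℝ (fun x => φ x ^ 2) x e = 2 * φ x * inner ℝ (∇ φ x) e := by
    have h := ((hd x).hasFDerivAt.pow 2).fderiv
    rw [h]
    simp [gradient]
  have hg' (x : E) : fderiv ℝ (fun x => inner ℝ e x) x e = 1 := by
    have h := (innerSL ℝ e).hasFDerivAt (x := x)
    have h2 : fderiv ℝ (fun x => inner ℝ e x) x = innerSL ℝ e := h.fderiv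
    rw [h2]
    simp [he]
  have hi1 : Integrable (fun x => φ x ^ 2) μ :=
    (by fun_prop : Continuous fun x => φ x ^ 2).integrable_of_hasCompactSupport
      (hφc.comp_left (g := fun t : ℝ => t ^ 2) (by simp))
  have hi2 : Integrable (fun x => ‖∇ φ x‖ ^ 2) μ :=
    (by fun_prop : Continuous fun x => ‖∇ φ x‖ ^ 2).integrable_of_hasCompactSupport
      (hgs.comp_left (g := fun t : E => ‖t‖ ^ 2) (by simp))
  have hi3 : Integrable (fun x => 2 * φ x * inner ℝ (∇ φ x) e * inner ℝ e x) μ := by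
    refine (by fun_prop : Continuous fun x => 2 * φ x * inner ℝ (∇ φ x) e * inner ℝ e x)
      |>.integrable_of_hasCompactSupport ?_
    refine hφc.mono' ?_
    intro x hx
    apply subset_tsupport
    contrapose! hx
    simp_all
  have hi4 : Integrable (fun x => φ x ^ 2 * inner ℝ e x) μ := by
    refine (by fun_prop : Continuous fun x => φ x ^ 2 * inner ℝ e x)
      |>.integrable_of_hasCompactSupport ?_
    refine hφc.mono' ?_
    intro x hx
    apply subset_tsupport
    contrapose! hx
    simp_all
  -- Integration by parts along `e`: the linear function `⟨e, x⟩` has derivative `1`, so `∫ φ² = -∫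
  -- 2 φ ∂ₑφ ⟨e, x⟩`.
  have key := integral_mul_fderiv_eq_neg_fderiv_mul_of_integrable (μ := μ) (v := e)
    (f := fun x => φ x ^ 2) (g := fun x => inner ℝ e x)
    (by simpa only [hf2] using hi3) (by simpa only [hg', mul_one] using hi1) hi4
    (fun x _ => (hd x).pow 2) (fun x _ => ((innerSL ℝ e).differentiable x))
  simp only [hf2, hg', mul_one] at key
  -- Young's inequality, weighted so that half of `∫ φ²` is absorbed on the left; doubling `2 R ^ 2`
  -- gives the constant `4 R ^ 2`.
  have hpt : ∀ x, -(2 * φ x * inner ℝ (∇ φ x) e * inner ℝ e x) ≤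
      2⁻¹ * φ x ^ 2 + 2 * R ^ 2 * ‖∇ φ x‖ ^ 2 := by
    intro x
    by_cases hx : x ∈ tsupport φ
    · have h1 : |inner ℝ (∇ φ x) e| ≤ ‖∇ φ x‖ := by
        simpa [he] using abs_real_inner_le_norm (∇ φ x) e
      have h2 : |inner ℝ e x| ≤ R := by
        have := abs_real_inner_le_norm e x
        rw [he, one_mul] at this
        exact this.trans (hR x hx)
      have h3 : |inner ℝ (∇ φ x) e * inner ℝ e x| ≤ ‖∇ φ x‖ * R := by
        rw [abs_mul]
        gcongr
      have h4 : (inner ℝ (∇ φ x) e * inner ℝ e x) ^ 2 ≤ (‖∇ φ x‖ * R) ^ 2 := by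
        rw [← sq_abs]
        gcongr
      nlinarith [sq_nonneg (φ x + 2 * (inner ℝ (∇ φ x) e * inner ℝ e x))]
    · rw [image_eq_zero_of_notMem_tsupport hx]
      simp only [mul_zero, zero_mul, neg_zero]
      positivity
  have hle := integral_mono hi3.neg ((hi1.const_mul 2⁻¹).add (hi2.const_mul (2 * R ^ 2))) hpt
  simp only [Pi.neg_apply, Pi.add_apply] at hle
  rw [integral_neg, ← key, integral_add (hi1.const_mul _) (hi2.const_mul _),
    integral_const_mul, integral_const_mul] at hle
  linarith

variable {d : ℕ} {Ω : Set (EuclideanSpace ℝ (Fin d))}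

theorem Lp_norm_sq_eq_integral {E F : Type*} [MeasurableSpace E] {μ : Measure E}
    [NormedAddCommGroup F] [InnerProductSpace ℝ F] (f : Lp F 2 μ) :
    ‖f‖ ^ 2 = ∫ x, ‖f x‖ ^ 2 ∂μ := by
  rw [← real_inner_self_eq_norm_sq, L2.inner_def]
  simp only [real_inner_self_eq_norm_sq]

theorem norm_fst_sq_le_of_mem_testPairs (hd : 1 ≤ d) {R : ℝ} (hR : ∀ x ∈ Ω, ‖x‖ ≤ R)
    {w : L2Pair Ω} (hw : w ∈ testPairs Ω) : ‖w.fst‖ ^ 2 ≤ 4 * R ^ 2 * ‖w.snd‖ ^ 2 := by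
  obtain ⟨φ, hφ, hφc, hφs, h1, h2⟩ := hw
  have e1 : ‖w.fst‖ ^ 2 = ∫ x, φ x ^ 2 := by
    rw [Lp_norm_sq_eq_integral,
      ← setIntegral_eq_integral_of_forall_compl_eq_zero (f := fun x => φ x ^ 2) (s := Ω)]
    · refine integral_congr_ae ?_
      filter_upwards [h1] with x hx
      simp [hx]
    · intro x hx
      simp [image_eq_zero_of_notMem_tsupport fun h => hx (hφs h)]
  have e2 : ‖w.snd‖ ^ 2 = ∫ x, ‖∇ φ x‖ ^ 2 := by
    rw [Lp_norm_sq_eq_integral,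
      ← setIntegral_eq_integral_of_forall_compl_eq_zero (f := fun x => ‖∇ φ x‖ ^ 2) (s := Ω)]
    · refine integral_congr_ae ?_
      filter_upwards [h2] with x hx
      simp [hx]
    · intro x hx
      have h0 : fderiv ℝ φ x = 0 := by
        by_contra h
        exact hx (hφs (support_fderiv_subset ℝ (f := φ) h))
      simp [gradient, h0]
  rw [e1, e2]
  -- Since `d ≥ 1`, a coordinate vector provides the unit direction.
  exact integral_sq_le_integral_norm_gradient_sq (hφ.of_le (by norm_cast)) hφc
    (e := EuclideanSpace.single ⟨0, hd⟩ 1) (by simp) fun x hx => hR x (hφs hx)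

/-- The Poincaré inequality in `H₀¹(Ω)`. -/
theorem norm_fn_sq_le (hd : 1 ≤ d) {R : ℝ} (hR : ∀ x ∈ Ω, ‖x‖ ≤ R) (y : H10 Ω) :
    ‖fn y‖ ^ 2 ≤ 4 * R ^ 2 * ‖weakGrad y‖ ^ 2 := by
  -- Both sides are continuous in the `H¹` norm, so the bound passes from test functions to their
  -- closure.
  have hc : IsClosed {w : L2Pair Ω | ‖w.fst‖ ^ 2 ≤ 4 * R ^ 2 * ‖w.snd‖ ^ 2} :=
    isClosed_le (by fun_prop) (by fun_prop)
  exact closure_minimal (fun w hw => norm_fst_sq_le_of_mem_testPairs hd hR hw) hc y.2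

theorem dirichletForm_eq_inner (y v : H10 Ω) :
    dirichletForm y v = inner ℝ (weakGrad y) (weakGrad v) := rfl

theorem norm_sq_le_dirichletForm (hd : 1 ≤ d) {R : ℝ} (hR : ∀ x ∈ Ω, ‖x‖ ≤ R) (y : H10 Ω) :
    ‖y‖ ^ 2 ≤ (4 * R ^ 2 + 1) * dirichletForm y y := by
  have h : ‖y‖ ^ 2 = ‖fn y‖ ^ 2 + ‖weakGrad y‖ ^ 2 := WithLp.prod_norm_sq_eq_of_L2 (y : L2Pair Ω)
  rw [h, dirichletForm_eq_inner, real_inner_self_eq_norm_sq]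
  linarith [norm_fn_sq_le hd hR y]

end Poincare

/-! ### The smoothed sign as an approximate subgradient -/

section Beta

theorem arctan_le_self_of_nonneg {x : ℝ} (hx : 0 ≤ x) : Real.arctan x ≤ x := by
  rcases hx.eq_or_lt with rfl | hx
  · simp
  · simpa [Real.tan_arctan] using
      (Real.lt_tan (Real.arctan_pos.2 hx) (Real.arctan_lt_pi_div_two x)).le

theorem abs_beta_le_one (γ s : ℝ) : |beta γ s| ≤ 1 := by
  have h := Real.pi_pos
  rw [beta, abs_mul, abs_of_pos (by positivity)]
  have h2 : |Real.arctan (γ * s)| ≤ Real.pi / 2 :=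
    abs_le.2 ⟨(Real.neg_pi_div_two_lt_arctan _).le, (Real.arctan_lt_pi_div_two _).le⟩
  calc 2 / Real.pi * |Real.arctan (γ * s)| ≤ 2 / Real.pi * (Real.pi / 2) := by gcongr
    _ = 1 := by field_simp

theorem beta_neg (γ s : ℝ) : beta γ (-s) = -beta γ s := by
  simp [beta, Real.arctan_neg]

/-- By oddness take `s > 0`. As `arctan t = π/2 - arctan (1/t)` for `t > 0`, the left side is `(2/π)
s arctan (1/(γ s))`, and `arctan x ≤ x` cancels the factor `s`. -/
theorem abs_sub_beta_mul_self_le {γ : ℝ} (hγ : 0 < γ) (s : ℝ) :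
    |s| - beta γ s * s ≤ 2 / (Real.pi * γ) := by
  have h := Real.pi_pos
  wlog hs : 0 ≤ s generalizing s
  · simpa [beta_neg] using this (-s) (by linarith)
  rcases hs.eq_or_lt with rfl | hs
  · simp; positivity
  have hp : 0 < γ * s := by positivity
  have h1 := Real.arctan_inv_of_pos hp
  have h2 := arctan_le_self_of_nonneg (inv_nonneg.2 hp.le)
  calc |s| - beta γ s * s = 2 / Real.pi * s * (γ * s)⁻¹ -
        2 / Real.pi * s * ((γ * s)⁻¹ - Real.arctan (γ * s)⁻¹) := by
        rw [h1, beta, abs_of_pos hs]; field_simp; ring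
    _ ≤ 2 / Real.pi * s * (γ * s)⁻¹ :=
        sub_le_self _ (mul_nonneg (by positivity) (sub_nonneg.2 h2))
    _ = 2 / (Real.pi * γ) := by field_simp

theorem abs_sub_abs_sub_beta_mul_le {γ : ℝ} (hγ : 0 < γ) (s t : ℝ) :
    |s| - |t| - beta γ s * (s - t) ≤ 2 / (Real.pi * γ) := by
  have h1 := abs_sub_beta_mul_self_le hγ s
  have h2 : beta γ s * t ≤ |t| := by
    refine (le_abs_self _).trans ?_
    rw [abs_mul]
    exact mul_le_of_le_one_left (abs_nonneg _) (abs_beta_le_one γ s)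
  linarith

end Beta

/-! ### Energy estimate and convergence -/

section Convergence

variable {d : ℕ} {Ω : Set (EuclideanSpace ℝ (Fin d))}

theorem fn_sub_ae (y z : H10 Ω) :
    ∀ᵐ x ∂volume.restrict Ω, fn (y - z) x = fn y x - fn z x :=
  Lp.coeFn_sub (fn y) (fn z)

theorem integrable_fn (hΩ : volume Ω < ⊤) (y : H10 Ω) :
    Integrable (fn y) (volume.restrict Ω) := by
  have : IsFiniteMeasure (volume.restrict Ω) := ⟨by simpa using hΩ⟩
  exact (Lp.memLp (fn y)).integrable one_le_two

theorem integrable_beta_mul_fn (hΩ : volume Ω < ⊤) (γ : ℝ) (y v : H10 Ω) :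
    Integrable (fun x => beta γ (fn y x) * fn v x) (volume.restrict Ω) := by
  refine (integrable_fn hΩ v).bdd_mul (c := 1) ?_ (ae_of_all _ fun x => abs_beta_le_one _ _)
  have hc : Continuous (beta γ) := by unfold beta; fun_prop
  exact hc.comp_aestronglyMeasurable (Lp.aestronglyMeasurable (fn y))

theorem l1Norm_sub_sub_integral_beta_le (hΩ : volume Ω < ⊤) {γ : ℝ} (hγ : 0 < γ) (y z : H10 Ω) :
    l1Norm y - l1Norm z - ∫ x in Ω, beta γ (fn y x) * fn (y - z) x ≤
      2 / (Real.pi * γ) * volume.real Ω := by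
  have : IsFiniteMeasure (volume.restrict Ω) := ⟨by simpa using hΩ⟩
  have hy := (integrable_fn hΩ y).abs
  have hz := (integrable_fn hΩ z).abs
  have hb := integrable_beta_mul_fn hΩ γ y (y - z)
  rw [l1Norm, l1Norm, ← integral_sub hy hz, ← integral_sub (f := fun x => |fn y x| - |fn z x|) (hy.sub hz) hb]
  refine (integral_mono_ae ((hy.sub hz).sub hb) (integrable_const (2 / (Real.pi * γ))) ?_).trans ?_
  · filter_upwards [fn_sub_ae y z] with x hx
    simpa [hx] using abs_sub_abs_sub_beta_mul_le hγ (fn y x) (fn z x)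
  · simp [mul_comm]

theorem dirichletForm_sub_sub_le (hΩ : volume Ω < ⊤) {γ : ℝ} (hγ : 0 < γ) {u u₀ : Hm1 Ω}
    {y y₀ : H10 Ω} (hy : IsRegularizedSolution γ u y) (hy₀ : IsVISolution u₀ y₀) :
    dirichletForm (y - y₀) (y - y₀) ≤
      ‖u - u₀‖ * ‖y - y₀‖ + 2 / (Real.pi * γ) * volume.real Ω := by
  have h1 := hy (y - y₀)
  have h2 := hy₀ y
  have h3 := l1Norm_sub_sub_integral_beta_le hΩ hγ y y₀
  have h4 : dirichletForm (y - y₀) (y - y₀) =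
      dirichletForm y (y - y₀) - dirichletForm y₀ (y - y₀) :=
    inner_sub_left (weakGrad y) (weakGrad y₀) (weakGrad (y - y₀))
  have h5 : (u - u₀) (y - y₀) ≤ ‖u - u₀‖ * ‖y - y₀‖ :=
    (le_abs_self _).trans ((u - u₀).le_opNorm _)
  rw [sub_apply] at h5
  linarith

/-- Quantitative distance between the regularized solution and the solution of the variational
inequality. -/
theorem norm_sub_sq_le (hd : 1 ≤ d) {R : ℝ} (hR : ∀ x ∈ Ω, ‖x‖ ≤ R) (hΩ : volume Ω < ⊤)
    {γ : ℝ} (hγ : 0 < γ) {u u₀ : Hm1 Ω} {y y₀ : H10 Ω} (hy : IsRegularizedSolution γ u y)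
    (hy₀ : IsVISolution u₀ y₀) :
    ‖y - y₀‖ ^ 2 ≤ (4 * R ^ 2 + 1) ^ 2 * ‖u - u₀‖ ^ 2 +
      4 * (4 * R ^ 2 + 1) / Real.pi * volume.real Ω * γ⁻¹ := by
  have h1 := norm_sq_le_dirichletForm hd hR (y - y₀)
  have h2 := mul_le_mul_of_nonneg_left (dirichletForm_sub_sub_le hΩ hγ hy hy₀)
    (by positivity : 0 ≤ 4 * R ^ 2 + 1)
  -- With `C = 4 R ^ 2 + 1`, this is `2 C ‖u - u₀‖ ‖y - y₀‖ ≤ C² ‖u - u₀‖² + ‖y - y₀‖²`; the last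
  -- term is absorbed after doubling the energy bound.
  have h3 := sq_nonneg ((4 * R ^ 2 + 1) * ‖u - u₀‖ - ‖y - y₀‖)
  have h4 : (4 * R ^ 2 + 1) * (2 / (Real.pi * γ) * volume.real Ω) * 2 =
      4 * (4 * R ^ 2 + 1) / Real.pi * volume.real Ω * γ⁻¹ := by
    field_simp; ring
  linarith

theorem tendsto_of_norm_sub_sq_le {E ι : Type*} [SeminormedAddCommGroup E] {l : Filter ι}
    {y : ι → E} {y₀ : E} {r : ι → ℝ} (h : ∀ᶠ i in l, ‖y i - y₀‖ ^ 2 ≤ r i)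
    (hr : Tendsto r l (𝓝 0)) : Tendsto y l (𝓝 y₀) := by
  have hsq : Tendsto (fun i => ‖y i - y₀‖ ^ 2) l (𝓝 0) :=
    squeeze_zero' (Eventually.of_forall fun i => sq_nonneg _) h hr
  rw [tendsto_iff_norm_sub_tendsto_zero]
  simpa using hsq.sqrt

theorem tendsto_norm_dual_sub {V ι : Type*} [SeminormedAddCommGroup V]
    [NormedSpace ℝ V] {l : Filter ι} {u : ι → V →L[ℝ] ℝ} {u₀ : V →L[ℝ] ℝ}
    (hu : Tendsto u l (𝓝 u₀)) : Tendsto (fun i => ‖u i - u₀‖) l (𝓝 0) :=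
  tendsto_iff_norm_sub_tendsto_zero.1 hu

end Convergence

end SemilinearVI

theorem theoremA1 {d : ℕ} (hd : 1 ≤ d) (Ω : Set (EuclideanSpace ℝ (Fin d)))
    (hΩ : IsOpen Ω) (hΩb : Bornology.IsBounded Ω)
    {ι : Type*} (l : Filter ι) (γ : ι → ℝ) (hγ : Tendsto γ l atTop)
    (u : ι → SemilinearVI.Hm1 Ω) (u₀ : SemilinearVI.Hm1 Ω) (hu : Tendsto u l (𝓝 u₀))
    (y : ι → SemilinearVI.H10 Ω)
    (hy : ∀ᶠ i in l, SemilinearVI.IsRegularizedSolution (γ i) (u i) (y i))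
    (y₀ : SemilinearVI.H10 Ω) (hy₀ : SemilinearVI.IsVISolution u₀ y₀) :
    Tendsto y l (𝓝 y₀) := by
  obtain ⟨R, hR⟩ := hΩb.exists_norm_le
  have hu' : Tendsto (fun i => ‖u i - u₀‖) l (𝓝 0) := SemilinearVI.tendsto_norm_dual_sub hu
  have hlim : Tendsto (fun i => (4 * R ^ 2 + 1) ^ 2 * ‖u i - u₀‖ ^ 2 +
      4 * (4 * R ^ 2 + 1) / Real.pi * volume.real Ω * (γ i)⁻¹) l (𝓝 0) := by
    simpa using ((hu'.pow 2).const_mul ((4 * R ^ 2 + 1) ^ 2)).add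
      ((tendsto_inv_atTop_zero.comp hγ).const_mul
        (4 * (4 * R ^ 2 + 1) / Real.pi * volume.real Ω))
  refine SemilinearVI.tendsto_of_norm_sub_sq_le ?_ hlim
  filter_upwards [hy, hγ.eventually_gt_atTop 0] with i hi hγi
  exact SemilinearVI.norm_sub_sq_le hd hR hΩb.measure_lt_top hγi hi hy₀
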